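/- Let $\tau\in\mathbb{C}$ with $\operatorname{Im}\tau>0$, put $q=e^{2\pi i\tau}$ and $q^{r}=e^{2\pi i r\tau}$, and let $$(a;q)_\infty=\prod_{k=0}^\infty(1-aq^k),\qquad \theta_1(z|\tau)=2\sum_{n=0}^\infty(-1)^nq^{(2n+1)^2/8}\sin\big((2n+1)z\big).$$ Then for all $x,y\in\mathbb{C}$ $$\begin{aligned} &q^{1/4}(q;q)_\infty^2\,\theta_1(3y|3\tau)\left(e^{2ix}\theta_1(3x+\pi\tau|3\tau)+e^{-2ix}\theta_1(3x-\pi\tau|3\tau)\right)\\ &\quad-q^{1/4}(q;q)_\infty^2\,\theta_1(3x|3\tau)\left(e^{2iy}\theta_1(3y+\pi\tau|3\tau)+e^{-2iy}\theta_1(3y-\pi\tau|3\tau)\right)\\ &=\theta_1(x|\tau)\,\theta_1(y|\tau)\,\theta_1(x+y|\tau)\,\theta_1(x-y|\tau). \end{aligned}$$ Moreover, for each such $\tau$, the validity of this identity for all $x,y\in\mathbb{C}$ is equivalent to the validity, for all nonzero $a,b\in\mathbb{C}$, of Winquist's identity $$\begin{aligned} &(q;q)_\infty^2\,(a;q)_\infty(q/a;q)_\infty(b;q)_\infty(q/b;q)_\infty(ab;q)_\infty(q/(ab);q)_\infty(a/b;q)_\infty(bq/a;q)_\infty\\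 &=\sum_{i=0}^\infty\sum_{j=-\infty}^\infty(-1)^{i+j}q^{3i(i+1)/2+j(3j+1)/2}\Big[(a^{-3i}-a^{3i+3})(b^{-3j}-b^{3j+1})+(a^{-3j+1}-a^{3j+2})(b^{3i+2}-b^{-3i-1})\Big], \end{aligned}$$ where the double series converges absolutely; in particular Winquist's identity holds as well. -/

import Mathlib

/-- The complex power `q ^ r` of the nome `q = exp (2 π i τ)`, that is `exp (2 π i r τ)`. -/
noncomputable def nomePow (τ r : ℂ) : ℂ :=
  Complex.exp (2 * (Real.pi : ℂ) * Complex.I * r * τ)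

/-- The nome `q = exp (2 π i τ)`. -/
noncomputable def nome (τ : ℂ) : ℂ :=
  Complex.exp (2 * (Real.pi : ℂ) * Complex.I * τ)

/-- The infinite `q`-shifted factorial `(a; q)_∞ = ∏_{k ≥ 0} (1 - a q ^ k)`. -/
noncomputable def qPochInf (a q : ℂ) : ℂ :=
  ∏' k : ℕ, (1 - a * q ^ k)

/-- The Jacobi theta function
`θ₁(z | τ) = 2 ∑_{n ≥ 0} (-1) ^ n q ^ ((2 n + 1) ^ 2 / 8) sin ((2 n + 1) z)`. -/
noncomputable def jacobiTheta1 (z τ : ℂ) : ℂ :=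
  2 * ∑' n : ℕ, (-1 : ℂ) ^ n * nomePow τ ((2 * (n : ℂ) + 1) ^ 2 / 8)
    * Complex.sin ((2 * (n : ℂ) + 1) * z)

/-- The theta function identity, at the points `x` and `y`. -/
def ThetaIdentityAt (τ x y : ℂ) : Prop :=
  nomePow τ (1 / 4) * qPochInf (nome τ) (nome τ) ^ 2 * jacobiTheta1 (3 * y) (3 * τ) *
      (Complex.exp (2 * Complex.I * x) * jacobiTheta1 (3 * x + (Real.pi : ℂ) * τ) (3 * τ) +
        Complex.exp (-(2 * Complex.I * x)) * jacobiTheta1 (3 * x - (Real.pi : ℂ) * τ) (3 * τ))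
    - nomePow τ (1 / 4) * qPochInf (nome τ) (nome τ) ^ 2 * jacobiTheta1 (3 * x) (3 * τ) *
      (Complex.exp (2 * Complex.I * y) * jacobiTheta1 (3 * y + (Real.pi : ℂ) * τ) (3 * τ) +
        Complex.exp (-(2 * Complex.I * y)) * jacobiTheta1 (3 * y - (Real.pi : ℂ) * τ) (3 * τ))
    = jacobiTheta1 x τ * jacobiTheta1 y τ * jacobiTheta1 (x + y) τ * jacobiTheta1 (x - y) τ

/-- The term with indices `(i, j)` of the double series in Winquist's identity. The exponent
`i (i + 1) / 2` is taken in `ℕ` and `j (3 j + 1) / 2` in `ℤ`; both divisions are exact. -/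
noncomputable def winquistTerm (q a b : ℂ) (i : ℕ) (j : ℤ) : ℂ :=
  (-1 : ℂ) ^ i * (-1 : ℂ) ^ j *
    ((a ^ (-3 * (i : ℤ)) - a ^ (3 * (i : ℤ) + 3)) * (b ^ (-3 * j) - b ^ (3 * j + 1)) +
      (a ^ (-3 * j + 1) - a ^ (3 * j + 2)) * (b ^ (3 * (i : ℤ) + 2) - b ^ (-3 * (i : ℤ) - 1))) *
    (q ^ (3 * (i * (i + 1) / 2)) * q ^ (j * (3 * j + 1) / 2))

/-- Winquist's identity, for the base `q` and the nonzero parameters `a` and `b`: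
`(q; q)_∞ ^ 2 (a, q/a, b, q/b, ab, q/(ab), a/b, bq/a; q)_∞` is the sum of the (absolutely
convergent) double series with terms `winquistTerm q a b i j`, `i ≥ 0`, `j ∈ ℤ`. -/
def WinquistIdentityAt (q a b : ℂ) : Prop :=
  HasSum (fun p : ℕ × ℤ => winquistTerm q a b p.1 p.2)
    (qPochInf q q ^ 2 * (qPochInf a q * qPochInf (q / a) q) * (qPochInf b q * qPochInf (q / b) q) *
      (qPochInf (a * b) q * qPochInf (q / (a * b)) q) *
      (qPochInf (a / b) q * qPochInf (b * q / a) q))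

/-! Put `θ(z) = thetaSum q z`, `a = e^{2ix}`, `b = e^{2iy}`. Up to a common nonzero factor, the
theta identity and Winquist's identity are both the single statement `quadruple_thetaSum`: `b θ(a)
θ(b) θ(ab) θ(a/b) = (q;q)² (P(a) U(b) - U(a) P(b))`, with `P = cubicP`, `U = cubicU`. On the theta
side, `P` and `U` are the functions at `3τ` (`thetaIdentityAt_iff`). On Winquist's side, the triple
product turns each `θ` into a product, and expanding `P` and `U` gives the double series
(`winquistIdentityAt_iff`). These equivalences hold point by point, whether or not the statement is
true.

For fixed `b`, the function `θ(a) θ(ab) θ(a/b)` of `a` has Laurent coefficients with `c (n + 3) = -q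
^ n c n` and `c 2 = -c 1`, so it lies in the span of `P` and `U` (`exists_cubic_expansion`). Thus
the left side is `α(b) P(a) + β(b) U(a)`. At a primitive cube root of unity `a = ω`, `P` vanishes
and the product collapses to a multiple of `P(b)`, which gives `β`. Antisymmetry in `a` and `b`,
together with `P(-1) ≠ 0`, then gives `α`. -/

open Filter Topology

/-! ### Bilateral theta series and their functional equations -/

/-- The general term `(-1) ^ j q ^ (j (j - 1) / 2) z ^ j` of the bilateral theta series. -/
noncomputable def thetaTerm (q z : ℂ) (j : ℤ) : ℂ :=
  (-1 : ℂ) ^ j * q ^ (j * (j - 1) / 2) * z ^ j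

/-- The bilateral theta series `∑_{j ∈ ℤ} (-1) ^ j q ^ (j (j - 1) / 2) z ^ j`. -/
noncomputable def thetaSum (q z : ℂ) : ℂ := ∑' j : ℤ, thetaTerm q z j

lemma triangular_succ (j : ℤ) : (j + 1) * (j + 1 - 1) / 2 = j * (j - 1) / 2 + j := by
  rw [show (j + 1) * (j + 1 - 1) = j * (j - 1) + j * 2 by ring,
    Int.add_mul_ediv_right _ _ (by norm_num)]

lemma triangular_one_sub (j : ℤ) : (1 - j) * (1 - j - 1) / 2 = j * (j - 1) / 2 := by
  congr 1; ring

lemma two_mul_triangular (j : ℤ) : 2 * (j * (j - 1) / 2) = j * (j - 1) :=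
  Int.mul_ediv_cancel' (even_iff_two_dvd.mp (Int.even_mul_pred_self j))

lemma thetaTerm_add_one {q z : ℂ} (hq : q ≠ 0) (hz : z ≠ 0) (j : ℤ) :
    thetaTerm q z (j + 1) = -(q ^ j * z) * thetaTerm q z j := by
  unfold thetaTerm
  rw [triangular_succ, zpow_add₀ hq, zpow_add_one₀ hz, zpow_add_one₀ (by norm_num)]
  ring

lemma thetaTerm_sub_one {q z : ℂ} (hq : q ≠ 0) (hz : z ≠ 0) (j : ℤ) :
    thetaTerm q z j = -(q ^ (j - 1) * z) * thetaTerm q z (j - 1) := by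
  have := thetaTerm_add_one hq hz (j - 1)
  rwa [sub_add_cancel] at this

lemma thetaTerm_one_sub {q z : ℂ} (hz : z ≠ 0) (j : ℤ) :
    thetaTerm q z (1 - j) = -z * thetaTerm q z⁻¹ j := by
  unfold thetaTerm
  rw [triangular_one_sub, zpow_sub₀ hz, zpow_sub₀ (by norm_num), inv_zpow, zpow_one, zpow_one,
    show ((-1 : ℂ)) / (-1) ^ j = -((-1) ^ j) by
      rcases Int.even_or_odd j with h | h <;> simp [h.neg_one_zpow]]
  field_simp

lemma summable_thetaTerm_nat {q z : ℂ} (hq : q ≠ 0) (hq1 : ‖q‖ < 1) (hz : z ≠ 0) :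
    Summable fun n : ℕ => thetaTerm q z n := by
  have hne : ∀ n : ℕ, thetaTerm q z n ≠ 0 := fun n => by
    unfold thetaTerm
    exact mul_ne_zero (mul_ne_zero (zpow_ne_zero _ (by norm_num)) (zpow_ne_zero _ hq))
      (zpow_ne_zero _ hz)
  refine summable_of_ratio_test_tendsto_lt_one (l := 0) one_pos (.of_forall hne) ?_
  have h : Tendsto (fun n : ℕ => ‖q‖ ^ n * ‖z‖) atTop (𝓝 (0 * ‖z‖)) :=
    (tendsto_pow_atTop_nhds_zero_of_lt_one (norm_nonneg _) hq1).mul_const _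
  rw [zero_mul] at h
  refine h.congr fun n => ?_
  have := thetaTerm_add_one hq hz n
  push_cast
  rw [this, norm_mul, mul_div_assoc, div_self (norm_ne_zero_iff.mpr (hne n))]
  simp

lemma summable_thetaTerm {q z : ℂ} (hq : q ≠ 0) (hq1 : ‖q‖ < 1) (hz : z ≠ 0) :
    Summable (thetaTerm q z) := by
  refine Summable.of_nat_of_neg_add_one (summable_thetaTerm_nat hq hq1 hz) ?_
  -- The negative index `-(n + 1)` equals `1 - (n + 2)`, so the reflection `j ↦ 1 - j` turns this
  -- half into the positive half at `z⁻¹`, shifted by two.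
  have h := ((summable_nat_add_iff 2).mpr
    (summable_thetaTerm_nat hq hq1 (inv_ne_zero hz))).mul_left (-z)
  refine h.congr fun n => ?_
  rw [← thetaTerm_one_sub hz]
  congr 1

lemma hasSum_thetaSum {q z : ℂ} (hq : q ≠ 0) (hq1 : ‖q‖ < 1) (hz : z ≠ 0) :
    HasSum (thetaTerm q z) (thetaSum q z) :=
  (summable_thetaTerm hq hq1 hz).hasSum

lemma thetaSum_inv {q z : ℂ} (hz : z ≠ 0) : thetaSum q z = -z * thetaSum q z⁻¹ := by
  unfold thetaSum
  rw [← tsum_mul_left, ← (Equiv.subLeft (1 : ℤ)).tsum_eq]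
  exact tsum_congr fun j => thetaTerm_one_sub hz j

lemma thetaSum_mul_left {q z : ℂ} (hq : q ≠ 0) (hz : z ≠ 0) :
    thetaSum q z = -z * thetaSum q (q * z) := by
  unfold thetaSum
  rw [← tsum_mul_left, ← (Equiv.addRight (1 : ℤ)).tsum_eq]
  refine tsum_congr fun j => ?_
  rw [Equiv.coe_addRight, thetaTerm_add_one hq hz]
  unfold thetaTerm
  rw [mul_zpow]
  ring

/-! ### Central `q`-binomial coefficients and the finite triple product -/

/-- The finite product `(q; q)_n`. -/
noncomputable def qFact (q : ℂ) (n : ℕ) : ℂ := ∏ k ∈ Finset.range n, (1 - q ^ (k + 1))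

/-- The reciprocal of `(q; q)_m`, extended by zero to negative `m`. -/
noncomputable def qFactInv (q : ℂ) (m : ℤ) : ℂ := if 0 ≤ m then (qFact q m.toNat)⁻¹ else 0

lemma one_sub_pow_ne_zero {q : ℂ} (hq1 : ‖q‖ < 1) (k : ℕ) : 1 - q ^ (k + 1) ≠ 0 := by
  intro h
  have h1 : q ^ (k + 1) = 1 := (sub_eq_zero.mp h).symm
  have h2 : ‖q‖ ^ (k + 1) < 1 := pow_lt_one₀ (norm_nonneg _) hq1 (by omega)
  rw [← norm_pow, h1, norm_one] at h2
  exact lt_irrefl _ h2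

/-- Extending by zero keeps the recursion valid for every integer: at `m = 0` the factor `1 - q ^ m`
vanishes. -/
lemma qFactInv_sub_one {q : ℂ} (hq1 : ‖q‖ < 1) (m : ℤ) :
    qFactInv q (m - 1) = (1 - q ^ m) * qFactInv q m := by
  unfold qFactInv
  rcases lt_trichotomy m 0 with h | rfl | h
  · rw [if_neg (by omega), if_neg (by omega), mul_zero]
  · simp
  · obtain ⟨n, rfl⟩ : ∃ n : ℕ, m = n + 1 := ⟨(m - 1).toNat, by omega⟩
    rw [if_pos (by omega), if_pos (by omega), show ((n : ℤ) + 1 - 1).toNat = n by omega,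
      show ((n : ℤ) + 1).toNat = n + 1 by omega, qFact, qFact, Finset.prod_range_succ, mul_inv,
      ← Nat.cast_succ, zpow_natCast, mul_comm (_ : ℂ)⁻¹, ← mul_assoc,
      mul_inv_cancel₀ (one_sub_pow_ne_zero hq1 n), one_mul]

/-- The `q`-binomial coefficient `(q; q)_{2n} / ((q; q)_{n - j} (q; q)_{n + j})`. -/
noncomputable def centralQBinom (q : ℂ) (n : ℕ) (j : ℤ) : ℂ :=
  qFact q (2 * n) * qFactInv q (n - j) * qFactInv q (n + j)

/-- This is the comparison of coefficients of `z ^ j` when the finite product is multiplied by `(1 -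
z q ^ n) (1 - q ^ (n + 1) / z)`. After division by common factors it is a polynomial identity in
`q`, `q ^ (n - j)` and `q ^ (n + j)`. -/
lemma centralQBinom_succ {q : ℂ} (hq : q ≠ 0) (hq1 : ‖q‖ < 1) (n : ℕ) (j : ℤ) :
    centralQBinom q (n + 1) j = (1 + q ^ (2 * n + 1)) * centralQBinom q n j +
      q * q ^ ((n : ℤ) - j) * centralQBinom q n (j - 1) +
      q * q ^ ((n : ℤ) + j) * centralQBinom q n (j + 1) := by
  have h1 := qFactInv_sub_one hq1 ((n : ℤ) + 1 - j)
  have h2 := qFactInv_sub_one hq1 ((n : ℤ) - j)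
  have h3 := qFactInv_sub_one hq1 ((n : ℤ) + 1 + j)
  have h4 := qFactInv_sub_one hq1 ((n : ℤ) + j)
  rw [show (n : ℤ) + 1 - j - 1 = n - j by ring, show (n : ℤ) + 1 - j = n - j + 1 by ring,
    zpow_add_one₀ hq] at h1
  rw [show (n : ℤ) + 1 + j - 1 = n + j by ring, show (n : ℤ) + 1 + j = n + j + 1 by ring,
    zpow_add_one₀ hq] at h3
  have h5 : qFact q (2 * (n + 1)) =
      qFact q (2 * n) * (1 - q ^ (2 * n + 1)) * (1 - q ^ (2 * n + 2)) := by
    rw [qFact, qFact, show 2 * (n + 1) = 2 * n + 1 + 1 by ring, Finset.prod_range_succ,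
      Finset.prod_range_succ]
  have h6 : q ^ (2 * n) = q ^ ((n : ℤ) - j) * q ^ ((n : ℤ) + j) := by
    rw [← zpow_add₀ hq, ← zpow_natCast]; congr 1; push_cast; ring
  unfold centralQBinom
  rw [h5, pow_add q (2 * n), pow_add q (2 * n), h6]
  push_cast
  rw [show (n : ℤ) + 1 - j = n - j + 1 by ring, show (n : ℤ) + 1 + j = n + j + 1 by ring,
    show (n : ℤ) - (j - 1) = n - j + 1 by ring, show (n : ℤ) + (j - 1) = n + j - 1 by ring,
    show (n : ℤ) - (j + 1) = n - j - 1 by ring, show (n : ℤ) + (j + 1) = n + j + 1 by ring,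
    h2, h4, h1, h3]
  ring

/-- The finite form of the Jacobi triple product identity. -/
lemma hasSum_finite_triple_product {q z : ℂ} (hq : q ≠ 0) (hq1 : ‖q‖ < 1) (hz : z ≠ 0) (n : ℕ) :
    HasSum (fun j => thetaTerm q z j * centralQBinom q n j)
      ((∏ k ∈ Finset.range n, (1 - z * q ^ k)) *
        ∏ k ∈ Finset.range n, (1 - q / z * q ^ k)) := by
  induction n with
  | zero =>
    -- For `n = 0` one of the reciprocals has a negative index unless `j = 0`.
    have h : ∀ j : ℤ, j ≠ 0 → thetaTerm q z j * centralQBinom q 0 j = 0 := fun j hj => by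
      unfold centralQBinom qFactInv
      rcases lt_or_gt_of_ne hj with h | h
      · rw [if_neg (by push_cast; omega : ¬ 0 ≤ ((0 : ℕ) : ℤ) + j)]; ring
      · rw [if_neg (by push_cast; omega : ¬ 0 ≤ ((0 : ℕ) : ℤ) - j)]; ring
    have := hasSum_single 0 h
    simpa [thetaTerm, centralQBinom, qFactInv, qFact] using this
  | succ n ih =>
    have hd := (Equiv.subRight (1 : ℤ)).hasSum_iff.mpr ih
    have hu := (Equiv.addRight (1 : ℤ)).hasSum_iff.mpr ih
    have h := ((ih.mul_left (1 + q ^ (2 * n + 1))).add (hd.mul_left (-(q ^ n * z)))).add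
      (hu.mul_left (-(q ^ (n + 1) / z)))
    have hp : (∏ k ∈ Finset.range (n + 1), (1 - z * q ^ k)) *
        ∏ k ∈ Finset.range (n + 1), (1 - q / z * q ^ k) =
        (1 + q ^ (2 * n + 1) + -(q ^ n * z) + -(q ^ (n + 1) / z)) *
        ((∏ k ∈ Finset.range n, (1 - z * q ^ k)) *
          ∏ k ∈ Finset.range n, (1 - q / z * q ^ k)) := by
      rw [Finset.prod_range_succ, Finset.prod_range_succ]
      field_simp
      ring
    rw [hp, add_mul, add_mul]
    refine Eq.subst (motive := fun f => HasSum f _) (funext fun j => ?_) h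
    simp only [Function.comp, Equiv.subRight_apply, Equiv.coe_addRight]
    rw [centralQBinom_succ hq hq1, thetaTerm_add_one hq hz j, zpow_sub₀ hq, zpow_add₀ hq,
      zpow_natCast, thetaTerm_sub_one hq hz j, zpow_sub_one₀ hq]
    have := zpow_ne_zero j hq
    field_simp
    ring

/-! ### Infinite products and the Jacobi triple product -/

lemma summable_mul_pow {q : ℂ} (hq1 : ‖q‖ < 1) (a : ℂ) : Summable fun k : ℕ => ‖-(a * q ^ k)‖ := by
  simp only [norm_neg, norm_mul, norm_pow]
  exact (summable_geometric_of_lt_one (norm_nonneg _) hq1).mul_left _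

lemma multipliable_qPochInf {q : ℂ} (hq1 : ‖q‖ < 1) (a : ℂ) :
    Multipliable fun k : ℕ => 1 - a * q ^ k := by
  simpa only [sub_eq_add_neg] using multipliable_one_add_of_summable (summable_mul_pow hq1 a)

lemma tendsto_qPochInf {q : ℂ} (hq1 : ‖q‖ < 1) (a : ℂ) :
    Tendsto (fun n => ∏ k ∈ Finset.range n, (1 - a * q ^ k)) atTop (𝓝 (qPochInf a q)) :=
  (multipliable_qPochInf hq1 a).hasProd.tendsto_prod_nat

lemma qPochInf_ne_zero {q a : ℂ} (hq1 : ‖q‖ < 1) (h : ∀ k : ℕ, a * q ^ k ≠ 1) :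
    qPochInf a q ≠ 0 := by
  have := tprod_one_add_ne_zero_of_summable (f := fun k : ℕ => -(a * q ^ k))
    (fun k => by rw [← sub_eq_add_neg]; exact sub_ne_zero.mpr (h k).symm) (summable_mul_pow hq1 a)
  simpa only [← sub_eq_add_neg, qPochInf] using this

lemma qPochInf_ne_zero_of_norm_lt_one {q a : ℂ} (hq1 : ‖q‖ < 1) (ha : ‖a‖ < 1) :
    qPochInf a q ≠ 0 := by
  refine qPochInf_ne_zero hq1 fun k h => ?_
  have h1 : ‖a‖ * ‖q‖ ^ k = 1 := by rw [← norm_pow, ← norm_mul, h, norm_one]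
  have h2 : ‖q‖ ^ k ≤ 1 := pow_le_one₀ (norm_nonneg _) hq1.le
  nlinarith [norm_nonneg a]

lemma qPochInf_eq_mul {q : ℂ} (hq1 : ‖q‖ < 1) (a : ℂ) :
    qPochInf a q = (1 - a) * qPochInf (a * q) q := by
  refine tendsto_nhds_unique ((tendsto_add_atTop_iff_nat 1).mpr (tendsto_qPochInf hq1 a))
    (((tendsto_qPochInf hq1 (a * q)).const_mul (1 - a)).congr fun n => ?_)
  rw [Finset.prod_range_succ', mul_comm]
  congr 1
  · exact Finset.prod_congr rfl fun k _ => by ring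
  · simp

/-- Factor by factor, `(1 - X) (1 - ω X) (1 - ω² X) = 1 - X³`. -/
lemma qPochInf_mul_cubeRoots {q ω : ℂ} (hq1 : ‖q‖ < 1) (hω : 1 + ω + ω ^ 2 = 0) (a : ℂ) :
    qPochInf a q * qPochInf (ω * a) q * qPochInf (ω ^ 2 * a) q = qPochInf (a ^ 3) (q ^ 3) := by
  unfold qPochInf
  rw [← (multipliable_qPochInf hq1 _).tprod_mul (multipliable_qPochInf hq1 _),
    ← ((multipliable_qPochInf hq1 _).mul (multipliable_qPochInf hq1 _)).tprod_mul
      (multipliable_qPochInf hq1 _)]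
  refine tprod_congr fun k => ?_
  have h3 : ω ^ 3 = 1 := by linear_combination (ω - 1) * hω
  rw [← pow_mul, mul_comm 3 k, pow_mul]
  linear_combination (-(a * q ^ k) + ω * (a * q ^ k) ^ 2) * hω -
    (a * q ^ k) ^ 3 * h3

lemma norm_pow_three_lt_one {q : ℂ} (hq1 : ‖q‖ < 1) : ‖q ^ 3‖ < 1 := by
  rw [norm_pow]; exact pow_lt_one₀ (norm_nonneg _) hq1 (by norm_num)

/-- The factors `1 - q ^ m` are sorted by `m` modulo 3; partial products are compared at length `3
n`. -/
lemma qPochInf_trisection {q : ℂ} (hq1 : ‖q‖ < 1) :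
    qPochInf q (q ^ 3) * qPochInf (q ^ 2) (q ^ 3) * qPochInf (q ^ 3) (q ^ 3) = qPochInf q q := by
  have h3 := norm_pow_three_lt_one hq1
  refine tendsto_nhds_unique
    (((tendsto_qPochInf h3 q).mul (tendsto_qPochInf h3 (q ^ 2))).mul (tendsto_qPochInf h3 (q ^ 3)))
    (((tendsto_qPochInf hq1 q).comp (tendsto_id.const_mul_atTop' (by norm_num : 0 < 3))).congr
      fun n => ?_)
  simp only [Function.comp, id]
  induction n with
  | zero => simp
  | succ n ih =>
    rw [show 3 * (n + 1) = 3 * n + 1 + 1 + 1 by ring, Finset.prod_range_succ,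
      Finset.prod_range_succ, Finset.prod_range_succ, ih, Finset.prod_range_succ,
      Finset.prod_range_succ, Finset.prod_range_succ]
    ring

lemma qFact_eq (q : ℂ) (n : ℕ) : qFact q n = ∏ k ∈ Finset.range n, (1 - q * q ^ k) :=
  Finset.prod_congr rfl fun k _ => by ring

lemma tendsto_qFact {q : ℂ} (hq1 : ‖q‖ < 1) : Tendsto (qFact q) atTop (𝓝 (qPochInf q q)) :=
  (tendsto_qPochInf hq1 q).congr fun n => (qFact_eq q n).symm

lemma tendsto_qFactInv {q : ℂ} (hq1 : ‖q‖ < 1) :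
    Tendsto (qFactInv q) atTop (𝓝 (qPochInf q q)⁻¹) := by
  have h : Tendsto (fun m : ℤ => m.toNat) atTop atTop :=
    tendsto_atTop_atTop.mpr fun n => ⟨n, fun m hm => by omega⟩
  refine (((tendsto_qFact hq1).inv₀ (qPochInf_ne_zero_of_norm_lt_one hq1 hq1)).comp h).congr' ?_
  filter_upwards [eventually_ge_atTop 0] with m hm
  simp [qFactInv, hm]

lemma exists_norm_qFact_le {q : ℂ} (hq1 : ‖q‖ < 1) : ∃ C, ∀ n, ‖qFact q n‖ ≤ C := by
  obtain ⟨C, hC⟩ := (tendsto_qFact hq1).norm.bddAbove_range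
  exact ⟨C, fun n => hC ⟨n, rfl⟩⟩

lemma exists_norm_qFactInv_le {q : ℂ} (hq1 : ‖q‖ < 1) : ∃ C, ∀ m, ‖qFactInv q m‖ ≤ C := by
  obtain ⟨C, hC⟩ :=
    ((tendsto_qFactInv hq1).comp tendsto_natCast_atTop_atTop).norm.bddAbove_range
  refine ⟨C, fun m => ?_⟩
  rcases lt_or_ge m 0 with h | h
  · rw [qFactInv, if_neg (by omega), norm_zero]
    exact (norm_nonneg _).trans (hC ⟨0, rfl⟩)
  · lift m to ℕ using h
    exact hC ⟨m, rfl⟩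

lemma tendsto_centralQBinom {q : ℂ} (hq1 : ‖q‖ < 1) (j : ℤ) :
    Tendsto (fun n => centralQBinom q n j) atTop (𝓝 (qPochInf q q)⁻¹) := by
  have h1 := (tendsto_qFact hq1).comp (tendsto_id.const_mul_atTop' (by norm_num : 0 < 2))
  have hc : Tendsto (fun n : ℕ => (n : ℤ)) atTop atTop := tendsto_natCast_atTop_atTop
  have h2 := (tendsto_qFactInv hq1).comp (tendsto_atTop_add_const_right atTop (-j) hc)
  have h3 := (tendsto_qFactInv hq1).comp (tendsto_atTop_add_const_right atTop j hc)
  have h := (h1.mul h2).mul h3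
  rw [mul_inv_cancel₀ (qPochInf_ne_zero_of_norm_lt_one hq1 hq1), one_mul] at h
  exact h

/-- The Jacobi triple product identity. -/
theorem thetaSum_eq_qPochInf {q z : ℂ} (hq : q ≠ 0) (hq1 : ‖q‖ < 1) (hz : z ≠ 0) :
    thetaSum q z = qPochInf q q * qPochInf z q * qPochInf (q / z) q := by
  obtain ⟨C, hC⟩ := exists_norm_qFact_le hq1
  obtain ⟨D, hD⟩ := exists_norm_qFactInv_le hq1
  -- Each central coefficient tends to `1 / (q;q)_∞` and is bounded by `C * D * D` uniformly in `n`
  -- and `j`, so the limit passes through the series.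
  have h1 := tendsto_tsum_of_dominated_convergence (𝓕 := atTop)
    (f := fun n j => thetaTerm q z j * centralQBinom q n j)
    ((summable_thetaTerm hq hq1 hz).norm.mul_right (C * D * D))
    (fun j => (tendsto_centralQBinom hq1 j).const_mul _)
    (.of_forall fun n j => by
      have hC0 := (norm_nonneg _).trans (hC 0)
      have hD0 := (norm_nonneg _).trans (hD 0)
      rw [norm_mul]
      refine mul_le_mul_of_nonneg_left ?_ (norm_nonneg _)
      rw [centralQBinom, norm_mul, norm_mul]
      gcongr
      exacts [hC _, hD _, hD _])
  simp only [(hasSum_finite_triple_product hq hq1 hz _).tsum_eq, tsum_mul_right] at h1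
  have h2 := tendsto_nhds_unique h1 ((tendsto_qPochInf hq1 z).mul (tendsto_qPochInf hq1 (q / z)))
  rw [thetaSum, mul_assoc, ← h2]
  field_simp [qPochInf_ne_zero_of_norm_lt_one hq1 hq1]

/-! ### The two-dimensional space of cubic theta functions -/

/-- The cubic theta function `∑ (-1) ^ n q ^ (3 n (n - 1) / 2) a ^ (3 n)`, summed over `n ∈ ℤ`. -/
noncomputable def cubicP (q a : ℂ) : ℂ := thetaSum (q ^ 3) (a ^ 3)

/-- The cubic theta function which, with `cubicP`, spans the Laurent series satisfying
`f (q a) = -a⁻³ f a` and `f a⁻¹ = -a⁻³ f a`. -/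
noncomputable def cubicU (q a : ℂ) : ℂ :=
  a * thetaSum (q ^ 3) (q * a ^ 3) - a ^ 2 * thetaSum (q ^ 3) (q ^ 2 * a ^ 3)

/-- Along a residue class modulo 3 the recursion for `c` is that of `thetaTerm` with base `q ^ 3`
and argument `q ^ r`. -/
lemma cubic_coeff {q : ℂ} (hq : q ≠ 0) {c : ℤ → ℂ} (hc : ∀ n, c (n + 3) = -q ^ n * c n) (r k : ℤ) :
    c (k * 3 + r) = thetaTerm (q ^ 3) (q ^ r) k * c r := by
  have hq3 : q ^ 3 ≠ 0 := pow_ne_zero 3 hq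
  have hr : q ^ r ≠ 0 := zpow_ne_zero r hq
  have step : ∀ k : ℤ, c ((k + 1) * 3 + r) = -((q ^ 3) ^ k * q ^ r) * c (k * 3 + r) := fun k => by
    rw [show (k + 1) * 3 + r = k * 3 + r + 3 by ring, hc, zpow_add₀ hq, mul_comm k 3, zpow_mul]
    norm_cast
  induction k using Int.induction_on with
  | zero => simp [thetaTerm]
  | succ k ih => rw [step, ih, thetaTerm_add_one hq3 hr]; ring
  | pred k ih =>
    have h := step (-k - 1)
    rw [sub_add_cancel, ih, thetaTerm_sub_one hq3 hr, mul_assoc] at h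
    exact (mul_left_cancel₀
      (neg_ne_zero.mpr (mul_ne_zero (zpow_ne_zero _ hq3) hr)) h).symm

/-- A Laurent series whose coefficients satisfy the cubic recursion and are antisymmetric about
`3 / 2` is a combination of `cubicP` and `cubicU`. -/
lemma hasSum_cubic {q : ℂ} (hq : q ≠ 0) (hq1 : ‖q‖ < 1) {c : ℤ → ℂ}
    (hc : ∀ n, c (n + 3) = -q ^ n * c n) (h12 : c 2 = -c 1) {a : ℂ} (ha : a ≠ 0) :
    HasSum (fun n => c n * a ^ n) (c 0 * cubicP q a + c 1 * cubicU q a) := by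
  have hq3 : q ^ 3 ≠ 0 := pow_ne_zero 3 hq
  have key : ∀ r : Fin 3, HasSum (fun k : ℤ => c (k * 3 + (r : ℕ)) * a ^ (k * 3 + ((r : ℕ) : ℤ)))
      (c (r : ℕ) * a ^ (r : ℕ) * thetaSum (q ^ 3) (q ^ (r : ℕ) * a ^ 3)) := fun r => by
    have h := (hasSum_thetaSum hq3 (norm_pow_three_lt_one hq1)
      (mul_ne_zero (pow_ne_zero (r : ℕ) hq) (pow_ne_zero 3 ha))).mul_left (c (r : ℕ) * a ^ (r : ℕ))
    refine Eq.subst (motive := fun f => HasSum f _) (funext fun k => ?_) h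
    rw [cubic_coeff hq hc, thetaTerm, thetaTerm, mul_zpow, zpow_add₀ ha, mul_comm k 3, zpow_mul]
    norm_cast
    ring
  -- The series is split by residue modulo 3: class 0 gives `cubicP`, and classes 1 and 2 merge into
  -- `cubicU` because `c 2 = -c 1`.
  have key' : ∀ r : Fin 3, HasSum (fun n : ℤ => if n % 3 = (r : ℕ) then c n * a ^ n else 0)
      (c (r : ℕ) * a ^ (r : ℕ) * thetaSum (q ^ 3) (q ^ (r : ℕ) * a ^ 3)) := fun r => by
    have hinj : Function.Injective fun k : ℤ => k * 3 + ((r : ℕ) : ℤ) := fun k l h => by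
      dsimp only at h; omega
    refine (hinj.hasSum_iff fun n hn => if_neg fun h => hn ⟨n / 3, ?_⟩).mp ?_
    · dsimp only; omega
    · refine Eq.subst (motive := fun f => HasSum f _) (funext fun k => ?_) (key r)
      have := r.isLt
      simp only [Function.comp]
      rw [if_pos (by omega)]
  have h := hasSum_sum (s := Finset.univ) fun r _ => key' r
  have hval : ∑ r : Fin 3, c (r : ℕ) * a ^ (r : ℕ) * thetaSum (q ^ 3) (q ^ (r : ℕ) * a ^ 3) =
      c 0 * cubicP q a + c 1 * cubicU q a := by
    simp only [Fin.sum_univ_three, cubicP, cubicU]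
    norm_num [h12]
    ring
  rw [hval] at h
  refine Eq.subst (motive := fun f => HasSum f _) (funext fun n => ?_) h
  rw [Fin.sum_univ_three]
  have : n % 3 = 0 ∨ n % 3 = 1 ∨ n % 3 = 2 := by omega
  rcases this with h | h | h <;> simp [h]

/-- The product of three theta series with arguments `a`, `a b`, `a / b` is a combination of
`cubicP q a` and `cubicU q a` with coefficients independent of `a`. -/
lemma exists_cubic_expansion {q b : ℂ} (hq : q ≠ 0) (hq1 : ‖q‖ < 1) (hb : b ≠ 0) :
    ∃ α β : ℂ, ∀ a ≠ 0, thetaSum q a * thetaSum q (a * b) * thetaSum q (a / b) =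
      α * cubicP q a + β * cubicU q a := by
  -- The first coordinate of the source is the total degree in `a`; `c n` below is then the
  -- coefficient of `a ^ n` in the triple product.
  let e : ℤ × ℤ × ℤ ≃ ℤ × ℤ × ℤ :=
    { toFun := fun p => (p.1 - p.2.1 - p.2.2, p.2.1, p.2.2)
      invFun := fun p => (p.1 + p.2.1 + p.2.2, p.2.1, p.2.2)
      left_inv := fun p => Prod.ext (by dsimp only; ring) rfl
      right_inv := fun p => Prod.ext (by dsimp only; ring) rfl }
  let g : ℤ → ℤ × ℤ → ℂ := fun n p =>
    thetaTerm q 1 (n - p.1 - p.2) * (thetaTerm q b p.1 * thetaTerm q b⁻¹ p.2)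
  let c : ℤ → ℂ := fun n => ∑' p, g n p
  have hbi := inv_ne_zero hb
  -- Raising all three indices by one raises the degree by 3 and multiplies the term by `-q ^ n`.
  have hc : ∀ n, c (n + 3) = -q ^ n * c n := fun n => by
    simp only [c]
    rw [← tsum_mul_left, ← (Equiv.addRight ((1, 1) : ℤ × ℤ)).tsum_eq]
    refine tsum_congr fun p => ?_
    simp only [g, Equiv.coe_addRight, Prod.fst_add, Prod.snd_add]
    rw [show n + 3 - (p.1 + 1) - (p.2 + 1) = n - p.1 - p.2 + 1 by ring,
      thetaTerm_add_one hq one_ne_zero, thetaTerm_add_one hq hb, thetaTerm_add_one hq hbi]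
    have : q ^ n = q ^ (n - p.1 - p.2) * q ^ p.1 * q ^ p.2 := by
      rw [← zpow_add₀ hq, ← zpow_add₀ hq]; congr 1; ring
    rw [this]
    field_simp
  -- Reflecting each index by `j ↦ 1 - j` sends degree 1 to degree 2; it exchanges `b` and `b⁻¹`,
  -- hence the swap of the last two indices.
  have h12 : c 2 = -c 1 := by
    simp only [c]
    rw [← tsum_neg, ← ((Equiv.prodComm ℤ ℤ).trans (Equiv.subLeft ((1, 1) : ℤ × ℤ))).tsum_eq]
    refine tsum_congr fun p => ?_
    simp only [g, Equiv.trans_apply, Equiv.prodComm_apply, Equiv.subLeft_apply, Prod.fst_sub,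
      Prod.snd_sub, Prod.fst_swap, Prod.snd_swap]
    rw [show (2 : ℤ) - (1 - p.2) - (1 - p.1) = 1 - (1 - p.1 - p.2) by ring,
      thetaTerm_one_sub one_ne_zero, thetaTerm_one_sub hb, thetaTerm_one_sub hbi, inv_inv, inv_one]
    field_simp
  refine ⟨c 0, c 1, fun a ha => ?_⟩
  have h1 := (summable_thetaTerm hq hq1 ha).norm
  have h2 := (summable_thetaTerm hq hq1 (mul_ne_zero ha hb)).norm
  have h3 := (summable_thetaTerm hq hq1 (div_ne_zero ha hb)).norm
  have h23 : Summable fun p : ℤ × ℤ => ‖thetaTerm q (a * b) p.1 * thetaTerm q (a / b) p.2‖ :=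
    h2.mul_norm h3
  have hs : HasSum (fun p : ℤ × ℤ × ℤ => thetaTerm q a p.1 *
      (thetaTerm q (a * b) p.2.1 * thetaTerm q (a / b) p.2.2))
      (thetaSum q a * thetaSum q (a * b) * thetaSum q (a / b)) := by
    rw [mul_assoc, thetaSum, thetaSum, thetaSum, tsum_mul_tsum_of_summable_norm h2 h3,
      tsum_mul_tsum_of_summable_norm h1 h23]
    exact (h1.mul_norm h23).of_norm.hasSum
  have he : ∀ p, thetaTerm q a (e p).1 *
      (thetaTerm q (a * b) (e p).2.1 * thetaTerm q (a / b) (e p).2.2) = g p.1 p.2 * a ^ p.1 :=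
    fun p => by
      simp only [e, g, Equiv.coe_fn_mk, thetaTerm, mul_zpow, div_zpow, inv_zpow, zpow_sub₀ ha,
        one_zpow]
      have := zpow_ne_zero p.2.1 ha
      have := zpow_ne_zero p.2.2 ha
      have := zpow_ne_zero p.2.2 hb
      field_simp
  have hs' := e.hasSum_iff.mpr hs
  have hs'' : HasSum (fun p : ℤ × ℤ × ℤ => g p.1 p.2 * a ^ p.1) _ :=
    Eq.subst (motive := fun f => HasSum f _) (funext he) hs'
  have hf := hs''.prod_fiberwise fun n => (hs''.summable.prod_factor n).hasSum
  simp only [tsum_mul_right] at hf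
  exact hf.unique (hasSum_cubic hq hq1 hc h12 ha)

/-! ### Values at cube roots of unity and the quadruple product -/

lemma thetaSum_div_left {q z : ℂ} (hq : q ≠ 0) (hz : z ≠ 0) :
    thetaSum q (q / z) = thetaSum q z := by
  rw [thetaSum_mul_left hq hz, thetaSum_inv (div_ne_zero hq hz), inv_div]
  have h := thetaSum_mul_left hq (div_ne_zero hz hq)
  rw [mul_div_cancel₀ _ hq] at h
  rw [← thetaSum_mul_left hq hz, h]
  field_simp

lemma exists_cubeRoot : ∃ ω : ℂ, 1 + ω + ω ^ 2 = 0 := by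
  have h := Complex.isPrimitiveRoot_exp 3 (by norm_num)
  exact ⟨_, by simpa [Finset.sum_range_succ] using h.geom_sum_eq_zero (by norm_num)⟩

lemma cubeRoot_pow_three {ω : ℂ} (hω : 1 + ω + ω ^ 2 = 0) : ω ^ 3 = 1 := by
  linear_combination (ω - 1) * hω

lemma cubeRoot_ne_zero {ω : ℂ} (hω : 1 + ω + ω ^ 2 = 0) : ω ≠ 0 := by
  rintro rfl; simp at hω

lemma one_sub_cubeRoot_ne_zero {ω : ℂ} (hω : 1 + ω + ω ^ 2 = 0) : 1 - ω ≠ 0 := by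
  intro h
  rw [← sub_eq_zero.mp h] at hω
  norm_num at hω

lemma qPochInf_one {q : ℂ} (hq1 : ‖q‖ < 1) : qPochInf 1 q = 0 := by
  rw [qPochInf_eq_mul hq1]; ring

lemma cubicP_cubeRoot {q ω : ℂ} (hq : q ≠ 0) (hq1 : ‖q‖ < 1) (hω : 1 + ω + ω ^ 2 = 0) :
    cubicP q ω = 0 := by
  have h3 := norm_pow_three_lt_one hq1
  rw [cubicP, cubeRoot_pow_three hω, thetaSum_eq_qPochInf (pow_ne_zero 3 hq) h3 one_ne_zero,
    qPochInf_one h3]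
  ring

lemma cubicU_cubeRoot {q ω : ℂ} (hq : q ≠ 0) (hq1 : ‖q‖ < 1) (hω : 1 + ω + ω ^ 2 = 0) :
    cubicU q ω = (ω - ω ^ 2) * qPochInf q q := by
  have h : thetaSum (q ^ 3) (q ^ 2) = thetaSum (q ^ 3) q := by
    rw [← thetaSum_div_left (pow_ne_zero 3 hq) hq]
    congr 1
    field_simp
  have h2 : q ^ 3 / q = q ^ 2 := by field_simp
  rw [cubicU, cubeRoot_pow_three hω, mul_one, mul_one, h,
    thetaSum_eq_qPochInf (pow_ne_zero 3 hq) (norm_pow_three_lt_one hq1) hq, h2,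
    ← qPochInf_trisection hq1]
  ring

lemma cubicP_eq_qPochInf {q a : ℂ} (hq : q ≠ 0) (hq1 : ‖q‖ < 1) (ha : a ≠ 0) :
    cubicP q a = qPochInf (q ^ 3) (q ^ 3) * qPochInf (a ^ 3) (q ^ 3) *
      qPochInf (q ^ 3 / a ^ 3) (q ^ 3) :=
  thetaSum_eq_qPochInf (pow_ne_zero 3 hq) (norm_pow_three_lt_one hq1) (pow_ne_zero 3 ha)

lemma cubicP_neg_one_ne_zero {q : ℂ} (hq : q ≠ 0) (hq1 : ‖q‖ < 1) : cubicP q (-1) ≠ 0 := by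
  have h3 := norm_pow_three_lt_one hq1
  rw [cubicP_eq_qPochInf hq hq1 (by norm_num)]
  refine mul_ne_zero (mul_ne_zero (qPochInf_ne_zero_of_norm_lt_one h3 h3) ?_)
    (qPochInf_ne_zero_of_norm_lt_one h3 (by simpa using h3))
  rw [qPochInf_eq_mul h3]
  refine mul_ne_zero (by norm_num) (qPochInf_ne_zero_of_norm_lt_one h3 (by simpa using h3))

lemma thetaSum_cubeRoot {q ω : ℂ} (hq : q ≠ 0) (hq1 : ‖q‖ < 1) (hω : 1 + ω + ω ^ 2 = 0) :
    thetaSum q ω = (1 - ω) * qPochInf (q ^ 3) (q ^ 3) := by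
  have h0 := cubeRoot_ne_zero hω
  have hd : q / ω = ω ^ 2 * q := by
    rw [div_eq_iff h0]; linear_combination (-q) * cubeRoot_pow_three hω
  rw [thetaSum_eq_qPochInf hq hq1 h0, ← qPochInf_mul_cubeRoots hq1 hω, qPochInf_eq_mul hq1 ω, hd]
  ring

/-- The value of the quadruple product when one variable is a primitive cube root of unity. -/
lemma quadruple_thetaSum_cubeRoot {q ω b : ℂ} (hq : q ≠ 0) (hq1 : ‖q‖ < 1)
    (hω : 1 + ω + ω ^ 2 = 0) (hb : b ≠ 0) :
    b * (thetaSum q ω * thetaSum q b * thetaSum q (ω * b) * thetaSum q (ω / b)) =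
      -(ω - ω ^ 2) * qPochInf q q ^ 3 * cubicP q b := by
  have h0 := cubeRoot_ne_zero hω
  have hw3 := cubeRoot_pow_three hω
  -- Inversion replaces `ω / b` by `ω² b`, so the three factors with argument `b`, `ω b`, `ω² b`
  -- combine into a function of `b ^ 3`.
  have hi : thetaSum q (ω / b) = -(ω / b) * thetaSum q (ω ^ 2 * b) := by
    rw [thetaSum_inv (div_ne_zero h0 hb), inv_div]
    congr 2
    rw [div_eq_iff h0]; linear_combination (-b) * hw3
  have e1 : q / (ω * b) = ω ^ 2 * (q / b) := by
    field_simp; linear_combination -hw3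
  have e2 : q / (ω ^ 2 * b) = ω * (q / b) := by
    field_simp; linear_combination -hw3
  rw [hi, thetaSum_cubeRoot hq hq1 hω, thetaSum_eq_qPochInf hq hq1 hb,
    thetaSum_eq_qPochInf hq hq1 (mul_ne_zero h0 hb),
    thetaSum_eq_qPochInf hq hq1 (mul_ne_zero (pow_ne_zero 2 h0) hb), e1, e2,
    cubicP_eq_qPochInf hq hq1 hb, ← div_pow, ← qPochInf_mul_cubeRoots hq1 hω b,
    ← qPochInf_mul_cubeRoots hq1 hω (q / b)]
  field_simp

/-- The quadruple theta product as an alternating combination of cubic theta functions. -/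
theorem quadruple_thetaSum {q a b : ℂ} (hq : q ≠ 0) (hq1 : ‖q‖ < 1) (ha : a ≠ 0) (hb : b ≠ 0) :
    b * (thetaSum q a * thetaSum q b * thetaSum q (a * b) * thetaSum q (a / b)) =
      qPochInf q q ^ 2 * (cubicP q a * cubicU q b - cubicU q a * cubicP q b) := by
  -- The case `b = 0` gets dummy coefficients so that `α` and `β` can be chosen as functions on all
  -- of `ℂ`.
  have hE : ∀ b : ℂ, ∃ α β : ℂ, b ≠ 0 → ∀ a ≠ 0,
      b * (thetaSum q a * thetaSum q b * thetaSum q (a * b) * thetaSum q (a / b)) =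
        α * cubicP q a + β * cubicU q a := fun b => by
    by_cases hb : b = 0
    · exact ⟨0, 0, fun h => absurd hb h⟩
    · obtain ⟨α, β, h⟩ := exists_cubic_expansion hq hq1 hb
      exact ⟨b * thetaSum q b * α, b * thetaSum q b * β, fun _ a ha => by
        linear_combination b * thetaSum q b * h a ha⟩
  choose α β hαβ using hE
  have hanti : ∀ a ≠ 0, ∀ b ≠ 0,
      b * (thetaSum q a * thetaSum q b * thetaSum q (a * b) * thetaSum q (a / b)) =
      -(a * (thetaSum q b * thetaSum q a * thetaSum q (b * a) * thetaSum q (b / a))) :=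
    fun a ha b hb => by
      rw [thetaSum_inv (div_ne_zero ha hb), inv_div, mul_comm b a]
      field_simp
  obtain ⟨ω, hω⟩ := exists_cubeRoot
  have hQ := qPochInf_ne_zero_of_norm_lt_one hq1 hq1
  have hω0 := cubeRoot_ne_zero hω
  have hβ : ∀ b ≠ 0, β b = -qPochInf q q ^ 2 * cubicP q b := fun b hb => by
    have h := hαβ b hb ω hω0
    rw [quadruple_thetaSum_cubeRoot hq hq1 hω hb, cubicP_cubeRoot hq hq1 hω,
      cubicU_cubeRoot hq hq1 hω] at h
    have hne : (ω - ω ^ 2) * qPochInf q q ≠ 0 := by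
      rw [show ω - ω ^ 2 = ω * (1 - ω) by ring]
      exact mul_ne_zero (mul_ne_zero hω0 (one_sub_cubeRoot_ne_zero hω)) hQ
    refine mul_left_cancel₀ hne ?_
    linear_combination -h
  -- With `γ = α - (q;q)² U`, antisymmetry reads `P(a) γ(b) + P(b) γ(a) = 0`. Taking `a = b = -1`
  -- gives `γ(-1) = 0`, and then `a = -1` alone gives `γ(b) = 0`.
  have hγ : ∀ a ≠ 0, ∀ b ≠ 0, cubicP q a * (α b - qPochInf q q ^ 2 * cubicU q b) +
      cubicP q b * (α a - qPochInf q q ^ 2 * cubicU q a) = 0 := fun a ha b hb => by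
    have h := hanti a ha b hb
    rw [hαβ b hb a ha, hαβ a ha b hb, hβ a ha, hβ b hb] at h
    linear_combination h
  have hm : (-1 : ℂ) ≠ 0 := by norm_num
  have hP := cubicP_neg_one_ne_zero hq hq1
  have hγm : α (-1) - qPochInf q q ^ 2 * cubicU q (-1) = 0 := by
    refine (mul_eq_zero.mp ?_).resolve_left hP
    linear_combination (1 / 2) * hγ _ hm _ hm
  have hγb : α b - qPochInf q q ^ 2 * cubicU q b = 0 := by
    have h := hγ _ hm b hb
    rw [hγm, mul_zero, add_zero] at h
    exact (mul_eq_zero.mp h).resolve_left hP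
  rw [hαβ b hb a ha, hβ b hb]
  linear_combination cubicP q a * hγb

/-! ### Series for the cubic functions and Winquist's double series -/

lemma hasSum_thetaSum_nat {q z : ℂ} (hq : q ≠ 0) (hq1 : ‖q‖ < 1) (hz : z ≠ 0) :
    HasSum (fun n : ℕ => (-1 : ℂ) ^ n * q ^ (n * (n + 1) / 2) * (z ^ (-(n : ℤ)) - z ^ ((n : ℤ) + 1)))
      (thetaSum q z) := by
  have h := ((Equiv.addRight (1 : ℤ)).hasSum_iff.mpr
    (hasSum_thetaSum hq hq1 hz)).nat_add_neg_add_one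
  refine Eq.subst (motive := fun f => HasSum f _) (funext fun n => ?_) h
  -- The indices `n + 1` and `-n` share the triangular number `n (n + 1) / 2`, so their terms pair
  -- up with opposite signs.
  have e1 : ((n : ℤ) + 1) * (n + 1 - 1) / 2 = ((n * (n + 1) / 2 : ℕ) : ℤ) := by
    push_cast; congr 1; ring
  have e2 : (-(n : ℤ)) * (-n - 1) / 2 = ((n * (n + 1) / 2 : ℕ) : ℤ) := by
    push_cast; congr 1; ring
  have e3 : (-1 : ℂ) ^ (-(n : ℤ)) = (-1) ^ n := by
    rw [← inv_zpow', inv_neg, inv_one, zpow_natCast]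
  simp only [Function.comp, Equiv.coe_addRight]
  rw [neg_add, neg_add_cancel_right, thetaTerm, thetaTerm, e1, e2, e3,
    zpow_add_one₀ (by norm_num : (-1 : ℂ) ≠ 0), zpow_natCast, zpow_natCast]
  ring

lemma hasSum_cubicP {q a : ℂ} (hq : q ≠ 0) (hq1 : ‖q‖ < 1) (ha : a ≠ 0) :
    HasSum (fun i : ℕ => (-1 : ℂ) ^ i * q ^ (3 * (i * (i + 1) / 2)) *
      (a ^ (-3 * (i : ℤ)) - a ^ (3 * (i : ℤ) + 3))) (cubicP q a) := by
  refine Eq.subst (motive := fun f => HasSum f _) (funext fun i => ?_)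
    (hasSum_thetaSum_nat (pow_ne_zero 3 hq) (norm_pow_three_lt_one hq1) (pow_ne_zero 3 ha))
  have e : 3 * (i : ℤ) + 3 = (3 : ℕ) * ((i : ℤ) + 1) := by push_cast; ring
  have e' : -3 * (i : ℤ) = (3 : ℕ) * -(i : ℤ) := by push_cast; ring
  rw [pow_mul, e, e', zpow_mul, zpow_mul, zpow_natCast]

lemma hasSum_cubicU {q a : ℂ} (hq : q ≠ 0) (hq1 : ‖q‖ < 1) (ha : a ≠ 0) :
    HasSum (fun j : ℤ => (-1 : ℂ) ^ j * q ^ (j * (3 * j + 1) / 2) *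
      (a ^ (-3 * j + 1) - a ^ (3 * j + 2))) (cubicU q a) := by
  have hq3 := pow_ne_zero 3 hq
  have ha3 := pow_ne_zero 3 ha
  -- Negating the index in the first series gives both halves of `cubicU` the same exponent `j (3 j
  -- + 1) / 2`.
  have h1 := (Equiv.neg ℤ).hasSum_iff.mpr
    (hasSum_thetaSum hq3 (norm_pow_three_lt_one hq1) (mul_ne_zero hq ha3))
  have h2 := hasSum_thetaSum hq3 (norm_pow_three_lt_one hq1) (mul_ne_zero (pow_ne_zero 2 hq) ha3)
  refine Eq.subst (motive := fun f => HasSum f _) (funext fun j => ?_)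
    ((h1.mul_left a).sub (h2.mul_left (a ^ 2)))
  have t1 := two_mul_triangular j
  have t2 := two_mul_triangular (-j)
  have t3 : j * (3 * j + 1) / 2 = 3 * (j * (j - 1) / 2) + 2 * j := by
    rw [show j * (3 * j + 1) = (3 * (j * (j - 1) / 2) + 2 * j) * 2 by linear_combination (-3) * t1,
      Int.mul_ediv_cancel _ (by norm_num)]
  have t4 : 3 * (-j * (-j - 1) / 2) + -j = j * (3 * j + 1) / 2 := by
    linarith
  have e3 : (-1 : ℂ) ^ (-j) = (-1) ^ j := by rw [← inv_zpow', inv_neg, inv_one]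
  have p1 : (q ^ 3) ^ (-j * (-j - 1) / 2) * q ^ (-j) = q ^ (j * (3 * j + 1) / 2) := by
    rw [← t4, zpow_add₀ hq, zpow_mul]; norm_cast
  have p2 : (q ^ 3) ^ (j * (j - 1) / 2) * (q ^ 2) ^ j = q ^ (j * (3 * j + 1) / 2) := by
    rw [t3, zpow_add₀ hq, zpow_mul, zpow_mul]; norm_cast
  have p3 : a ^ (-3 * j + 1) = a * (a ^ 3) ^ (-j) := by
    rw [zpow_add_one₀ ha, show -3 * j = 3 * -j by ring, zpow_mul, mul_comm]; norm_cast
  have p4 : a ^ (3 * j + 2) = a ^ 2 * (a ^ 3) ^ j := by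
    rw [zpow_add₀ ha, zpow_mul, mul_comm]; norm_cast
  simp only [Function.comp, Equiv.neg_apply]
  rw [thetaTerm, thetaTerm, mul_zpow, mul_zpow, e3, p3, p4]
  linear_combination a * (-1) ^ j * (a ^ 3) ^ (-j) * p1 - a ^ 2 * (-1) ^ j * (a ^ 3) ^ j * p2

/-- The value of the double series in Winquist's identity. -/
lemma hasSum_winquistTerm {q a b : ℂ} (hq : q ≠ 0) (hq1 : ‖q‖ < 1) (ha : a ≠ 0) (hb : b ≠ 0) :
    HasSum (fun p : ℕ × ℤ => winquistTerm q a b p.1 p.2)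
      (b⁻¹ * (cubicP q a * cubicU q b - cubicU q a * cubicP q b)) := by
  have hmul : ∀ {f : ℕ → ℂ} {g : ℤ → ℂ} {x y : ℂ}, HasSum f x → HasSum g y →
      HasSum (fun p : ℕ × ℤ => f p.1 * g p.2) (x * y) := fun hf hg =>
    hf.mul hg (summable_mul_of_summable_norm hf.summable.norm hg.summable.norm)
  have h := ((hmul (hasSum_cubicP hq hq1 ha) (hasSum_cubicU hq hq1 hb)).sub
    (hmul (hasSum_cubicP hq hq1 hb) (hasSum_cubicU hq hq1 ha))).mul_left b⁻¹
  rw [mul_comm (cubicU q a)]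
  refine Eq.subst (motive := fun f => HasSum f _) (funext fun p => ?_) h
  obtain ⟨i, j⟩ := p
  have e1 : b ^ (-3 * j) = b⁻¹ * b ^ (-3 * j + 1) := by rw [zpow_add_one₀ hb]; field_simp
  have e2 : b ^ (3 * j + 1) = b⁻¹ * b ^ (3 * j + 2) := by
    rw [show 3 * j + 2 = 3 * j + 1 + 1 by ring, zpow_add_one₀ hb (3 * j + 1)]; field_simp
  have e3 : b ^ (3 * (i : ℤ) + 2) = b⁻¹ * b ^ (3 * (i : ℤ) + 3) := by
    rw [show 3 * (i : ℤ) + 3 = 3 * i + 2 + 1 by ring, zpow_add_one₀ hb (3 * (i : ℤ) + 2)]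
    field_simp
  have e4 : b ^ (-3 * (i : ℤ) - 1) = b⁻¹ * b ^ (-3 * (i : ℤ)) := by
    rw [zpow_sub_one₀ hb, mul_comm]
  simp only [winquistTerm]
  rw [e1, e2, e3, e4]
  ring

/-- Winquist's identity is the quadruple theta product identity written with infinite products. -/
lemma winquistIdentityAt_iff {q a b : ℂ} (hq : q ≠ 0) (hq1 : ‖q‖ < 1) (ha : a ≠ 0) (hb : b ≠ 0) :
    WinquistIdentityAt q a b ↔
      b * (thetaSum q a * thetaSum q b * thetaSum q (a * b) * thetaSum q (a / b)) =
        qPochInf q q ^ 2 * (cubicP q a * cubicU q b - cubicU q a * cubicP q b) := by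
  -- Four triple products contribute `(q;q) ^ 4`, but Winquist's product has only `(q;q) ^ 2`; the
  -- extra square must be cancelled.
  have hQ := qPochInf_ne_zero_of_norm_lt_one hq1 hq1
  have hs := hasSum_winquistTerm hq hq1 ha hb
  have hd : q / (a / b) = b * q / a := by field_simp
  rw [thetaSum_eq_qPochInf hq hq1 ha, thetaSum_eq_qPochInf hq hq1 hb,
    thetaSum_eq_qPochInf hq hq1 (mul_ne_zero ha hb),
    thetaSum_eq_qPochInf hq hq1 (div_ne_zero ha hb), hd, WinquistIdentityAt]
  constructor
  · intro h
    have := h.unique hs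
    rw [eq_inv_mul_iff_mul_eq₀ hb] at this
    linear_combination qPochInf q q ^ 2 * this
  · intro h
    convert hs using 1
    rw [eq_inv_mul_iff_mul_eq₀ hb]
    refine mul_left_cancel₀ (pow_ne_zero 2 hQ) ?_
    linear_combination h

/-! ### Translation to Jacobi's `θ₁` -/

lemma nome_ne_zero (τ : ℂ) : nome τ ≠ 0 := Complex.exp_ne_zero _

lemma norm_nome_lt_one {τ : ℂ} (hτ : 0 < τ.im) : ‖nome τ‖ < 1 :=
  UpperHalfPlane.norm_exp_two_pi_I_lt_one ⟨τ, hτ⟩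

/-- The Jacobi theta function as a bilateral series. -/
lemma jacobiTheta1_eq {τ : ℂ} (hτ : 0 < τ.im) (z : ℂ) :
    jacobiTheta1 z τ = Complex.I * nomePow τ (1 / 8) * Complex.exp (-(Complex.I * z)) *
      thetaSum (nome τ) (Complex.exp (2 * Complex.I * z)) := by
  have h := (hasSum_thetaSum_nat (nome_ne_zero τ) (norm_nome_lt_one hτ)
    (Complex.exp_ne_zero (2 * Complex.I * z))).mul_left
      (Complex.I * nomePow τ (1 / 8) * Complex.exp (-(Complex.I * z)))
  rw [← h.tsum_eq, jacobiTheta1, ← tsum_mul_left]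
  refine tsum_congr fun n => ?_
  -- Here `N = n (n + 1) / 2`, and `(2 n + 1)² / 8 = N + 1 / 8`.
  obtain ⟨N, hN⟩ := even_iff_two_dvd.mp (Nat.even_mul_succ_self n)
  have hN' : (n : ℂ) * (n + 1) = 2 * N := by exact_mod_cast hN
  have e1 : nomePow τ ((2 * (n : ℂ) + 1) ^ 2 / 8) = nomePow τ (1 / 8) * nome τ ^ N := by
    rw [nomePow, nomePow, nome, ← Complex.exp_nat_mul, ← Complex.exp_add]
    congr 1
    linear_combination (Real.pi * Complex.I * τ) * hN'
  have e2 : Complex.exp (-(Complex.I * z)) * Complex.exp (2 * Complex.I * z) ^ (-(n : ℤ)) =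
      Complex.exp (-((2 * (n : ℂ) + 1) * z) * Complex.I) := by
    rw [← Complex.exp_int_mul, ← Complex.exp_add]
    congr 1; push_cast; ring
  have e3 : Complex.exp (-(Complex.I * z)) * Complex.exp (2 * Complex.I * z) ^ ((n : ℤ) + 1) =
      Complex.exp (((2 * (n : ℂ) + 1) * z) * Complex.I) := by
    rw [← Complex.exp_int_mul, ← Complex.exp_add]
    congr 1; push_cast; ring
  rw [Nat.mul_succ] at hN ⊢
  rw [show (n * n + n) / 2 = N by omega, e1, Complex.sin, ← e2, ← e3]
  ring

lemma nome_three_mul (τ : ℂ) : nome (3 * τ) = nome τ ^ 3 := by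
  rw [nome, nome, ← Complex.exp_nat_mul]; congr 1; push_cast; ring

lemma nomePow_add (τ r s : ℂ) : nomePow τ (r + s) = nomePow τ r * nomePow τ s := by
  rw [nomePow, nomePow, nomePow, ← Complex.exp_add]; congr 1; ring

lemma jacobiTheta1_three_mul {τ : ℂ} (hτ : 0 < τ.im) (x : ℂ) :
    jacobiTheta1 (3 * x) (3 * τ) = Complex.I * nomePow τ (3 / 8) *
      Complex.exp (-(3 * Complex.I * x)) * cubicP (nome τ) (Complex.exp (2 * Complex.I * x)) := by
  have hτ3 : 0 < (3 * τ).im := by simpa using hτ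
  have e1 : nomePow (3 * τ) (1 / 8) = nomePow τ (3 / 8) := by
    rw [nomePow, nomePow]; congr 1; ring
  have e2 : Complex.exp (2 * Complex.I * (3 * x)) = Complex.exp (2 * Complex.I * x) ^ 3 := by
    rw [← Complex.exp_nat_mul]; congr 1; push_cast; ring
  have e3 : Complex.I * (3 * x) = 3 * Complex.I * x := by ring
  rw [jacobiTheta1_eq hτ3, nome_three_mul, cubicP, e1, e2, e3]

/-- Shifting by `±πτ` multiplies `a ^ 3 = e^{6ix}` by `q` or `q⁻¹`. The functional equation with
base `q ^ 3` moves `a ^ 3 / q` to `q ^ 2 a ^ 3`, which yields the second term of `cubicU`. -/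
lemma jacobiTheta1_three_mul_shift {τ : ℂ} (hτ : 0 < τ.im) (x : ℂ) :
    Complex.exp (2 * Complex.I * x) * jacobiTheta1 (3 * x + (Real.pi : ℂ) * τ) (3 * τ) +
        Complex.exp (-(2 * Complex.I * x)) * jacobiTheta1 (3 * x - (Real.pi : ℂ) * τ) (3 * τ) =
      Complex.I * nomePow τ (-1 / 8) * Complex.exp (-(3 * Complex.I * x)) *
        cubicU (nome τ) (Complex.exp (2 * Complex.I * x)) := by
  have hτ3 : 0 < (3 * τ).im := by simpa using hτ
  set a := Complex.exp (2 * Complex.I * x) with ha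
  set q := nome τ with hqdef
  have ha0 : a ≠ 0 := Complex.exp_ne_zero _
  have hq0 : q ≠ 0 := nome_ne_zero τ
  have a3 : a ^ 3 = Complex.exp (6 * Complex.I * x) := by
    rw [ha, ← Complex.exp_nat_mul]; congr 1; push_cast; ring
  have e1 : Complex.exp (2 * Complex.I * (3 * x + (Real.pi : ℂ) * τ)) = q * a ^ 3 := by
    rw [a3, hqdef, nome, ← Complex.exp_add]; congr 1; ring
  have e2 : Complex.exp (2 * Complex.I * (3 * x - (Real.pi : ℂ) * τ)) = a ^ 3 / q := by
    rw [a3, hqdef, nome, ← Complex.exp_sub]; congr 1; ring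
  have e3 : thetaSum (q ^ 3) (a ^ 3 / q) = -(a ^ 3 / q) * thetaSum (q ^ 3) (q ^ 2 * a ^ 3) := by
    rw [thetaSum_mul_left (pow_ne_zero 3 hq0) (div_ne_zero (pow_ne_zero 3 ha0) hq0)]
    congr 2
    field_simp
  have w1 : nomePow (3 * τ) (1 / 8) *
      Complex.exp (-(Complex.I * (3 * x + (Real.pi : ℂ) * τ))) =
      nomePow τ (-1 / 8) * Complex.exp (-(3 * Complex.I * x)) := by
    rw [nomePow, nomePow, ← Complex.exp_add, ← Complex.exp_add]; congr 1; ring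
  have w2 : nomePow (3 * τ) (1 / 8) *
      Complex.exp (-(Complex.I * (3 * x - (Real.pi : ℂ) * τ))) =
      q * (nomePow τ (-1 / 8) * Complex.exp (-(3 * Complex.I * x))) := by
    rw [hqdef, nome, nomePow, nomePow, ← Complex.exp_add, ← Complex.exp_add, ← Complex.exp_add]
    congr 1; ring
  rw [jacobiTheta1_eq hτ3, jacobiTheta1_eq hτ3, nome_three_mul, e1, e2, e3,
    mul_assoc Complex.I (nomePow (3 * τ) (1 / 8)), mul_assoc Complex.I (nomePow (3 * τ) (1 / 8)),
    w1, w2, Complex.exp_neg (2 * Complex.I * x), ← ha, cubicU]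
  field_simp
  ring

/-- The theta function identity is the quadruple theta product identity at `a = exp (2 i x)`,
`b = exp (2 i y)`. -/
lemma thetaIdentityAt_iff {τ : ℂ} (hτ : 0 < τ.im) (x y : ℂ) {q a b : ℂ} (hq : q = nome τ)
    (ha : a = Complex.exp (2 * Complex.I * x)) (hb : b = Complex.exp (2 * Complex.I * y)) :
    ThetaIdentityAt τ x y ↔
      b * (thetaSum q a * thetaSum q b * thetaSum q (a * b) * thetaSum q (a / b)) =
        qPochInf q q ^ 2 * (cubicP q a * cubicU q b - cubicU q a * cubicP q b) := by
  have hab : Complex.exp (2 * Complex.I * (x + y)) = a * b := by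
    rw [ha, hb, ← Complex.exp_add]; congr 1; ring
  have hdiv : Complex.exp (2 * Complex.I * (x - y)) = a / b := by
    rw [ha, hb, ← Complex.exp_sub]; congr 1; ring
  -- Both sides carry this nonzero factor; on the product side an extra `b` remains.
  set k := nomePow τ (1 / 2) * Complex.exp (-(3 * Complex.I * (x + y))) with hk
  have hk0 : k ≠ 0 := mul_ne_zero (Complex.exp_ne_zero _) (Complex.exp_ne_zero _)
  have k1 : nomePow τ (1 / 4) * nomePow τ (3 / 8) * nomePow τ (-1 / 8) *
      Complex.exp (-(3 * Complex.I * x)) * Complex.exp (-(3 * Complex.I * y)) = k := by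
    rw [← nomePow_add, ← nomePow_add, mul_assoc, ← Complex.exp_add, hk]
    congr 2
    · norm_num
    · ring
  have k2 : nomePow τ (1 / 8) ^ 4 * (Complex.exp (-(Complex.I * x)) *
      Complex.exp (-(Complex.I * y)) * Complex.exp (-(Complex.I * (x + y))) *
      Complex.exp (-(Complex.I * (x - y)))) = k * b := by
    rw [hk, hb, nomePow, nomePow, ← Complex.exp_nat_mul, ← Complex.exp_add, ← Complex.exp_add,
      ← Complex.exp_add, ← Complex.exp_add, ← Complex.exp_add, ← Complex.exp_add]
    congr 1; push_cast; ring
  have hI : Complex.I ^ 2 = -1 := Complex.I_sq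
  have hI4 : Complex.I ^ 4 = 1 := Complex.I_pow_four
  rw [ThetaIdentityAt, jacobiTheta1_three_mul_shift hτ, jacobiTheta1_three_mul_shift hτ,
    jacobiTheta1_three_mul hτ, jacobiTheta1_three_mul hτ, jacobiTheta1_eq hτ, jacobiTheta1_eq hτ,
    jacobiTheta1_eq hτ, jacobiTheta1_eq hτ, hab, hdiv, ← ha, ← hb, ← hq]
  have hl : nomePow τ (1 / 4) * qPochInf q q ^ 2 * (Complex.I * nomePow τ (3 / 8) *
      Complex.exp (-(3 * Complex.I * y)) * cubicP q b) * (Complex.I * nomePow τ (-1 / 8) *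
      Complex.exp (-(3 * Complex.I * x)) * cubicU q a) - nomePow τ (1 / 4) * qPochInf q q ^ 2 *
      (Complex.I * nomePow τ (3 / 8) * Complex.exp (-(3 * Complex.I * x)) * cubicP q a) *
      (Complex.I * nomePow τ (-1 / 8) * Complex.exp (-(3 * Complex.I * y)) * cubicU q b) =
      k * (qPochInf q q ^ 2 * (cubicP q a * cubicU q b - cubicU q a * cubicP q b)) := by
    rw [← k1]
    ring_nf
    rw [hI]
    ring
  have hr : Complex.I * nomePow τ (1 / 8) * Complex.exp (-(Complex.I * x)) * thetaSum q a *
      (Complex.I * nomePow τ (1 / 8) * Complex.exp (-(Complex.I * y)) * thetaSum q b) *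
      (Complex.I * nomePow τ (1 / 8) * Complex.exp (-(Complex.I * (x + y))) *
        thetaSum q (a * b)) *
      (Complex.I * nomePow τ (1 / 8) * Complex.exp (-(Complex.I * (x - y))) *
        thetaSum q (a / b)) =
      k * (b * (thetaSum q a * thetaSum q b * thetaSum q (a * b) * thetaSum q (a / b))) := by
    rw [← mul_assoc k b, ← k2]
    linear_combination nomePow τ (1 / 8) ^ 4 * (Complex.exp (-(Complex.I * x)) *
      Complex.exp (-(Complex.I * y)) * Complex.exp (-(Complex.I * (x + y))) *
      Complex.exp (-(Complex.I * (x - y)))) *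
      (thetaSum q a * thetaSum q b * thetaSum q (a * b) * thetaSum q (a / b)) * hI4
  rw [hl, hr, mul_right_inj' hk0, eq_comm]

theorem mainTheorem10 (τ : ℂ) (hτ : 0 < τ.im) :
    (∀ x y : ℂ, ThetaIdentityAt τ x y) ∧
      ((∀ x y : ℂ, ThetaIdentityAt τ x y) ↔
        ∀ a b : ℂ, a ≠ 0 → b ≠ 0 → WinquistIdentityAt (nome τ) a b) := by
  have hq := nome_ne_zero τ
  have hq1 := norm_nome_lt_one hτ
  have key : ∀ x y : ℂ, ThetaIdentityAt τ x y ↔ WinquistIdentityAt (nome τ)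
      (Complex.exp (2 * Complex.I * x)) (Complex.exp (2 * Complex.I * y)) := fun x y =>
    (thetaIdentityAt_iff hτ x y rfl rfl rfl).trans
      (winquistIdentityAt_iff hq hq1 (Complex.exp_ne_zero _) (Complex.exp_ne_zero _)).symm
  -- Every nonzero parameter is some `e^{2ix}`, so the pointwise equivalence reaches all of
  -- Winquist's parameters.
  have hsurj : ∀ a : ℂ, a ≠ 0 → ∃ x : ℂ, Complex.exp (2 * Complex.I * x) = a := fun a ha =>
    ⟨Complex.log a / (2 * Complex.I), by
      rw [mul_div_cancel₀ _ (by simp), Complex.exp_log ha]⟩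
  refine ⟨fun x y => (thetaIdentityAt_iff hτ x y rfl rfl rfl).mpr
    (quadruple_thetaSum hq hq1 (Complex.exp_ne_zero _) (Complex.exp_ne_zero _)),
    fun h a b ha hb => ?_, fun h x y => (key x y).mpr
      (h _ _ (Complex.exp_ne_zero _) (Complex.exp_ne_zero _))⟩
  obtain ⟨x, rfl⟩ := hsurj a ha
  obtain ⟨y, rfl⟩ := hsurj b hb
  exact (key x y).mp (h x y)
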